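/- For a profinite group $\mathcal{Q}$, let $p_{\mathcal{Q}}\colon\widetilde{\mathcal{Q}}\to\mathcal{Q}$ be its universal Frattini cover: $\widetilde{\mathcal{Q}}$ is a projective profinite group, $p_{\mathcal{Q}}$ is a continuous epimorphism, and a closed subgroup $S\leq\widetilde{\mathcal{Q}}$ is equal to $\widetilde{\mathcal{Q}}$ if and only if $p_{\mathcal{Q}}(S)=\mathcal{Q}$. For an abstract group $G$ with profinite completion $\widehat{G}$, let $\mathcal{K}_G=\ker(p_{\widehat{G}}\colon\widetilde{\widehat{G}}\to\widehat{G})$. **Theorem.** Let $G$ and $H$ be groups, and let $\iota\colon\widehat{G}\to\widehat{G*H}$ and $\rho\colon\widehat{G*H}\to\widehat{G}$ be the continuous homomorphisms induced by the inclusion $G\to G*H$ and by the projection $G*H\to G$ that is trivial on $H$. Then there is a continuous epimorphism $\mathcal{K}_{G*H}\to\mathcal{K}_G$. It is natural in the following sense. 1. There is a continuous homomorphism $\Phi\colon\widetilde{\widehat{G*H}}\to\widetilde{\widehat{G}}$ with $p_{\widehat{G}}\circ\Phi=\rho\circ p_{\widehat{G*H}}$ that restricts to a continuous epimorphism $\mathcal{K}_{G*H}\to\mathcal{K}_G$.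 2. Every continuous homomorphism $\psi\colon p_{\widehat{G*H}}^{-1}(\iota(\widehat{G}))\to\widetilde{\widehat{G}}$ with $\iota(p_{\widehat{G}}(\psi(x)))=p_{\widehat{G*H}}(x)$ for all $x$ restricts to a continuous epimorphism $\mathcal{K}_{G*H}\to\mathcal{K}_G$. -/

import Mathlib

universe u

/-- A continuous homomorphism `f : E → Q` of profinite groups is a *Frattini cover* if it is
surjective and a closed subgroup `S` of `E` is all of `E` if and only if `f(S) = Q`. -/
def IsFrattiniCover {E Q : ProfiniteGrp.{u}} (f : E →ₜ* Q) : Prop :=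
  Function.Surjective f ∧
    ∀ S : Subgroup E, IsClosed (S : Set E) → (S = ⊤ ↔ S.map (f : E →* Q) = ⊤)

/-- A profinite group `P` is *projective* if every continuous homomorphism from `P` to a profinite
group `A` lifts through every continuous epimorphism `α : B → A` of profinite groups. -/
def IsProjectiveProfinite (P : ProfiniteGrp.{u}) : Prop :=
  ∀ (A B : ProfiniteGrp.{u}) (α : B →ₜ* A) (φ : P →ₜ* A), Function.Surjective α →
    ∃ γ : P →ₜ* B, ∀ x, α (γ x) = φ x

/-- A *universal Frattini cover* is a Frattini cover with projective domain. -/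
def IsUniversalFrattiniCover {E Q : ProfiniteGrp.{u}} (f : E →ₜ* Q) : Prop :=
  IsFrattiniCover f ∧ IsProjectiveProfinite E

/-! ### Existence of universal Frattini covers -/

/-- Zorn's lemma for closed subgroups of a compact group meeting each set of a family of closed
sets. -/
theorem exists_minimal_closed_subgroup {P : Type u} [Group P] [TopologicalSpace P]
    [CompactSpace P] {ι : Type*} (C : ι → Set P) (hC : ∀ i, IsClosed (C i))
    (Q : Subgroup P → Prop) (hQcl : ∀ S, Q S → IsClosed (S : Set P))
    (hQ : ∀ c : Set (Subgroup P), c.Nonempty → (∀ S ∈ c, Q S) → Q (sInf c))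
    (S₀ : Subgroup P) (h₀ : Q S₀) (h₀C : ∀ i, ((S₀ : Set P) ∩ C i).Nonempty) :
    ∃ S : Subgroup P, (Q S ∧ ∀ i, ((S : Set P) ∩ C i).Nonempty) ∧
      ∀ T : Subgroup P, Q T → (∀ i, ((T : Set P) ∩ C i).Nonempty) → T ≤ S → T = S := by
  obtain ⟨S, -, hS⟩ := @zorn_le_nonempty₀ (Subgroup P)ᵒᵈ _
    {S : Subgroup P | Q S ∧ ∀ i, ((S : Set P) ∩ C i).Nonempty} (by
      intro c hc hchain y hy
      let c' : Set (Subgroup P) := c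
      refine ⟨(sInf c' : Subgroup P), ⟨hQ c' ⟨y, hy⟩ fun S hS => (hc hS).1, fun i => ?_⟩,
        fun z hz => (sInf_le hz : sInf c' ≤ z)⟩
      have : Nonempty c' := ⟨⟨y, hy⟩⟩
      have key := IsCompact.nonempty_iInter_of_directed_nonempty_isCompact_isClosed
        (fun S : c' => ((S : Subgroup P) : Set P) ∩ C i) (by
          intro S T
          rcases hchain.total S.2 T.2 with h | h
          · exact ⟨T, Set.inter_subset_inter_left _ h, subset_rfl⟩
          · exact ⟨S, subset_rfl, Set.inter_subset_inter_left _ h⟩)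
        (fun S => (hc S.2).2 i)
        (fun S => ((hQcl _ (hc S.2).1).inter (hC i)).isCompact)
        (fun S => (hQcl _ (hc S.2).1).inter (hC i))
      obtain ⟨x, hx⟩ := key
      rw [Set.mem_iInter] at hx
      refine ⟨x, ?_, (hx ⟨y, hy⟩).2⟩
      rw [SetLike.mem_coe, Subgroup.mem_sInf]
      exact fun S hS => (hx ⟨S, hS⟩).1) S₀ ⟨h₀, h₀C⟩
  refine ⟨S, hS.1, fun T hT hTC hTS => le_antisymm hTS (hS.2 (y := T) ⟨hT, hTC⟩ hTS)⟩

/-- A continuous homomorphism from a profinite group onto a closed subgroup, with values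
restricted to it. -/
def restrictRange {P R : ProfiniteGrp.{u}} (t : R →ₜ* P) (S : ClosedSubgroup P)
    (h : ∀ x, t x ∈ S.toSubgroup) : R →ₜ* (ProfiniteGrp.ofClosedSubgroup S) where
  toFun x := (⟨t x, h x⟩ : S.toSubgroup)
  map_one' := Subtype.ext (map_one t)
  map_mul' x y := Subtype.ext (map_mul t x y)
  continuous_toFun := Continuous.subtype_mk t.continuous_toFun h

/-- The inclusion of a closed subgroup. -/
def closedSubgroupInclusion {P : ProfiniteGrp.{u}} (S : ClosedSubgroup P) :
    (ProfiniteGrp.ofClosedSubgroup S) →ₜ* P where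
  toFun x := Subtype.val (p := (· ∈ S.toSubgroup)) x
  map_one' := rfl
  map_mul' _ _ := rfl
  continuous_toFun := continuous_subtype_val

/-- The profinite completion of a free group is a free profinite object. -/
theorem exists_lift_completion_freeGroup {X : Type u} (B : ProfiniteGrp.{u}) (b : X → B) :
    ∃ γ : ProfiniteGrp.ProfiniteCompletion.completion (GrpCat.of (FreeGroup X)) →ₜ* B,
      ∀ x, γ (ProfiniteGrp.ProfiniteCompletion.etaFn (GrpCat.of (FreeGroup X))
        (FreeGroup.of x)) = b x := by
  let g : GrpCat.of (FreeGroup X) ⟶ GrpCat.of B := GrpCat.ofHom (FreeGroup.lift b)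
  refine ⟨(ProfiniteGrp.ProfiniteCompletion.lift g).hom, fun x => ?_⟩
  have h := CategoryTheory.ConcreteCategory.congr_hom (ProfiniteGrp.ProfiniteCompletion.lift_eta g)
    (FreeGroup.of x)
  have h2 : g (FreeGroup.of x) = b x := FreeGroup.lift_apply_of
  exact h.trans h2

/-- A closed subgroup of the completion of a free group containing the generators is everything. -/
theorem eq_top_of_generators {X : Type u}
    (T : Subgroup (ProfiniteGrp.ProfiniteCompletion.completion (GrpCat.of (FreeGroup X))))
    (hT : IsClosed (T : Set (ProfiniteGrp.ProfiniteCompletion.completion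
      (GrpCat.of (FreeGroup X)))))
    (h : ∀ x, ProfiniteGrp.ProfiniteCompletion.etaFn (GrpCat.of (FreeGroup X))
        (FreeGroup.of x) ∈ T) : T = ⊤ := by
  have h1 : T.comap (ProfiniteGrp.ProfiniteCompletion.eta
      (GrpCat.of (FreeGroup X))).hom = ⊤ := by
    rw [eq_top_iff, ← FreeGroup.closure_range_of, Subgroup.closure_le]
    rintro _ ⟨x, rfl⟩
    exact h x
  have h2 : (T : Set (ProfiniteGrp.ProfiniteCompletion.completion
      (GrpCat.of (FreeGroup X)))) = Set.univ := by
    rw [← hT.closure_eq]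
    refine Dense.closure_eq ((ProfiniteGrp.ProfiniteCompletion.denseRange
      (GrpCat.of (FreeGroup X))).mono ?_)
    rintro _ ⟨y, rfl⟩
    have : y ∈ T.comap (ProfiniteGrp.ProfiniteCompletion.eta
      (GrpCat.of (FreeGroup X))).hom := h1 ▸ Subgroup.mem_top y
    exact this
  exact SetLike.coe_injective h2

/-- Every profinite group has a universal Frattini cover. -/
theorem exists_universalFrattiniCover (Q : ProfiniteGrp.{u}) :
    ∃ (E : ProfiniteGrp.{u}) (f : E →ₜ* Q), IsUniversalFrattiniCover f := by
  let P := ProfiniteGrp.ProfiniteCompletion.completion (GrpCat.of (FreeGroup Q))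
  let e : Q → P := fun x =>
    ProfiniteGrp.ProfiniteCompletion.etaFn (GrpCat.of (FreeGroup Q)) (FreeGroup.of x)
  have hlift : ∀ (B : ProfiniteGrp.{u}) (b : Q → B), ∃ γ : P →ₜ* B, ∀ x, γ (e x) = b x :=
    fun B b => exists_lift_completion_freeGroup B b
  have hgen : ∀ T : Subgroup P, IsClosed (T : Set P) → (∀ x, e x ∈ T) → T = ⊤ :=
    fun T hT h => eq_top_of_generators T hT h
  obtain ⟨π, hπ⟩ := hlift Q id
  have hπs : Function.Surjective π := fun y => ⟨e y, hπ y⟩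
  -- a minimal closed normal `M ≤ ker π` with `T M = P` for all closed `T` mapping onto `Q`
  let I := {p : Subgroup P × P // IsClosed (p.1 : Set P) ∧ ∀ y, ∃ x ∈ p.1, π x = y}
  obtain ⟨M, ⟨⟨hMcl, hMn, hMk⟩, hMC⟩, hMmin⟩ := exists_minimal_closed_subgroup (P := P)
    (fun i : I => {m : P | i.1.2 * m⁻¹ ∈ i.1.1})
    (fun i => i.2.1.preimage (by fun_prop))
    (fun M => IsClosed (M : Set P) ∧ M.Normal ∧ ∀ m ∈ M, π m = 1)
    (fun S h => h.1)
    (by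
      rintro c ⟨S, hS⟩ hc
      refine ⟨?_, ⟨fun n hn g => ?_⟩, fun m hm => (hc S hS).2.2 m (Subgroup.mem_sInf.1 hm S hS)⟩
      · rw [Subgroup.coe_sInf]
        exact isClosed_biInter fun S hS => (hc S hS).1
      · rw [Subgroup.mem_sInf] at hn ⊢
        exact fun T hT => (hc T hT).2.1.conj_mem n (hn T hT) g)
    (π : P →* Q).ker
    ⟨isClosed_singleton.preimage π.continuous_toFun, inferInstance, fun m hm => hm⟩
    (by
      rintro ⟨⟨T, x⟩, hT, hTs⟩
      obtain ⟨t, ht, htx⟩ := hTs (π x)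
      refine ⟨t⁻¹ * x, ?_, ?_⟩
      · change π (t⁻¹ * x) = 1
        simp [htx]
      · change x * (t⁻¹ * x)⁻¹ ∈ T
        simpa using ht)
  have hM : ∀ T : Subgroup P, IsClosed (T : Set P) → (∀ y, ∃ x ∈ T, π x = y) →
      ∀ x, ∃ s ∈ T, s⁻¹ * x ∈ M := by
    intro T hT hTs x
    obtain ⟨m, hm, hm'⟩ := hMC ⟨(T, x), hT, hTs⟩
    refine ⟨x * m⁻¹, hm', ?_⟩
    simpa using hm
  -- a minimal closed subgroup mapping onto `Q`
  obtain ⟨S, ⟨hScl, hSC⟩, hSmin⟩ := exists_minimal_closed_subgroup (P := P)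
    (fun y : Q => {x : P | π x = y})
    (fun y => isClosed_singleton.preimage π.continuous_toFun)
    (fun S => IsClosed (S : Set P)) (fun S h => h)
    (by
      rintro c - hc
      rw [Subgroup.coe_sInf]
      exact isClosed_biInter fun S hS => hc S hS)
    ⊤ isClosed_univ (fun y => (hπs y).imp fun x hx => ⟨trivial, hx⟩)
  have hSs : ∀ y, ∃ x ∈ S, π x = y := hSC
  have hSmin' : ∀ T : Subgroup P, IsClosed (T : Set P) → (∀ y, ∃ x ∈ T, π x = y) → T ≤ S →
      T = S := hSmin
  let S' : ClosedSubgroup P := ⟨S, hScl⟩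
  -- `t : P → S` with `t x ≡ x` modulo `M`
  choose b hbS hbM using fun x : Q => hM S hScl hSs (e x)
  obtain ⟨t', ht'⟩ := hlift (ProfiniteGrp.ofClosedSubgroup S')
    (fun x => (⟨b x, hbS x⟩ : S))
  let t : P →ₜ* P := (closedSubgroupInclusion S').comp t'
  have htS : ∀ x, t x ∈ S := fun x => (show S from t' x).2
  have htM : ∀ x, (t x)⁻¹ * x ∈ M := by
    let T : Subgroup P :=
      { carrier := {x | (t x)⁻¹ * x ∈ M}
        one_mem' := by simp
        mul_mem' := by
          intro x y hx hy
          have h1 := hMn.conj_mem _ hx (t y)⁻¹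
          have h2 := M.mul_mem h1 hy
          change (t (x * y))⁻¹ * (x * y) ∈ M
          simpa [mul_assoc] using h2
        inv_mem' := by
          intro x hx
          have h1 := hMn.conj_mem _ (M.inv_mem hx) (t x)
          change (t x⁻¹)⁻¹ * x⁻¹ ∈ M
          simpa [mul_assoc] using h1 }
    have hT : T = ⊤ := by
      refine hgen T ?_ fun x => ?_
      · exact hMcl.preimage ((t.continuous_toFun.inv).mul continuous_id)
      · change (t (e x))⁻¹ * e x ∈ M
        have : t (e x) = b x := congrArg (closedSubgroupInclusion S') (ht' x)
        rw [this]
        exact hbM x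
    exact fun x => (hT ▸ Subgroup.mem_top x : x ∈ T)
  have htπ : ∀ x, π (t x) = π x := by
    intro x
    have := hMk _ (htM x)
    rw [map_mul, map_inv, inv_mul_eq_one] at this
    exact this
  have hcont : Continuous t := t.continuous_toFun
  -- `t` maps every closed subgroup mapping onto `Q` onto `S`
  have htT : ∀ T : Subgroup P, IsClosed (T : Set P) → (∀ y, ∃ x ∈ T, π x = y) →
      T.map (t : P →* P) = S := by
    intro T hT hTs
    refine hSmin' _ (hT.isCompact.image hcont).isClosed (fun y => ?_) ?_
    · obtain ⟨x, hx, hxy⟩ := hTs y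
      exact ⟨t x, ⟨x, hx, rfl⟩, (htπ x).trans hxy⟩
    · rintro _ ⟨x, -, rfl⟩
      exact htS x
  have hker : (t : P →* P).ker = M := by
    refine hMmin _ ⟨isClosed_singleton.preimage hcont, inferInstance, fun m hm => ?_⟩ ?_ ?_
    · have hm' : t m = 1 := hm
      rw [← htπ m, hm', map_one]
    · rintro ⟨⟨T, x⟩, hT, hTs⟩
      have hx : t x ∈ T.map (t : P →* P) := by rw [htT T hT hTs]; exact htS x
      obtain ⟨s, hs, hsx⟩ := hx
      have hsx' : t s = t x := hsx
      refine ⟨s⁻¹ * x, ?_, ?_⟩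
      · change t (s⁻¹ * x) = 1
        simp [hsx']
      · change x * (s⁻¹ * x)⁻¹ ∈ T
        simpa using hs
    · intro x hx
      have hx' : t x = 1 := hx
      simpa [hx'] using htM x
  have htS_surj : ∀ x ∈ S, ∃ y ∈ S, t y = x := by
    intro x hx
    rw [← htT S hScl hSs] at hx
    exact hx
  have htS_inj : ∀ x ∈ S, t x = 1 → x = 1 := by
    intro x hx hx1
    obtain ⟨y, hy, rfl⟩ := htS_surj x hx
    have h1 : t y ∈ M := by rw [← hker]; exact hx1
    have h2 : y ∈ M := by simpa using M.mul_mem h1 (htM y)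
    rw [← hker] at h2
    exact h2
  -- the restriction of `t` to `S` is a topological automorphism
  let E := ProfiniteGrp.ofClosedSubgroup S'
  let j : E →ₜ* P := closedSubgroupInclusion S'
  have hjinj : Function.Injective j := Subtype.val_injective
  have hjS : ∀ x, j x ∈ S := fun x => (show S from x).2
  have hjt : ∀ x, j (t' x) = t x := fun x => rfl
  let σ : E →ₜ* E := t'.comp j
  have hσ : Function.Bijective σ := by
    constructor
    · rw [injective_iff_map_eq_one]
      intro x hx
      apply hjinj
      rw [map_one]
      exact htS_inj _ (hjS x) (by rw [← hjt]; exact (congrArg j hx).trans (map_one j))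
    · intro x
      obtain ⟨y, hy, hyx⟩ := htS_surj (j x) (hjS x)
      exact ⟨(⟨y, hy⟩ : S), hjinj hyx⟩
  let σe : E ≃* E := MulEquiv.ofBijective σ hσ
  let σh : E ≃ₜ E := Continuous.homeoOfEquivCompactToT2 (f := σe.toEquiv) σ.continuous_toFun
  let τ : E →ₜ* E := ⟨σe.symm.toMonoidHom, σh.symm.continuous⟩
  have hτ : ∀ x, τ (σ x) = x := fun x => σe.symm_apply_apply x
  refine ⟨E, π.comp j, ⟨?_, ?_⟩, ?_⟩
  · intro y
    obtain ⟨x, hx, hxy⟩ := hSs y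
    exact ⟨(⟨x, hx⟩ : S), hxy⟩
  · intro T hT
    constructor
    · rintro rfl
      rw [eq_top_iff]
      rintro y -
      obtain ⟨x, hx, hxy⟩ := hSs y
      exact ⟨(⟨x, hx⟩ : S), trivial, hxy⟩
    · intro h
      have h1 : T.map (j : E →* P) = S := by
        refine hSmin' _ (hT.isCompact.image j.continuous_toFun).isClosed (fun y => ?_) ?_
        · have hy : y ∈ T.map ((π.comp j : E →ₜ* Q) : E →* Q) := h ▸ Subgroup.mem_top y
          obtain ⟨x, hx, hxy⟩ := hy
          exact ⟨j x, ⟨x, hx, rfl⟩, hxy⟩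
        · rintro _ ⟨x, -, rfl⟩
          exact hjS x
      rw [eq_top_iff]
      rintro x -
      have hx : j x ∈ T.map (j : E →* P) := by rw [h1]; exact hjS x
      obtain ⟨z, hz, hzx⟩ := hx
      exact hjinj hzx ▸ hz
  · intro A B α φ hα
    choose β hβ using hα
    obtain ⟨γ, hγ⟩ := hlift B (fun x => β (φ (τ (t' (e x)))))
    refine ⟨γ.comp j, fun x => ?_⟩
    let ψ : P →ₜ* A := φ.comp (τ.comp t')
    have hT : (α.comp γ : P →* A).eqLocus (ψ : P →* A) = ⊤ := by
      refine hgen _ ?_ fun x => ?_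
      · exact isClosed_eq (α.comp γ).continuous_toFun ψ.continuous_toFun
      · change α (γ (e x)) = φ (τ (t' (e x)))
        rw [hγ, hβ]
    have hx : j x ∈ (α.comp γ : P →* A).eqLocus (ψ : P →* A) := hT ▸ Subgroup.mem_top _
    have hx' : α (γ (j x)) = φ (τ (t' (j x))) := hx
    exact hx'.trans (congrArg φ (hτ x))

/-! ### Universal Frattini covers and their kernels -/

/-- The domain of the universal Frattini cover of a profinite group `Q`
(well defined up to a topological isomorphism over `Q`). -/
noncomputable def universalFrattiniCover (Q : ProfiniteGrp.{u}) : ProfiniteGrp.{u} :=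
  (exists_universalFrattiniCover Q).choose

/-- The universal Frattini cover of `Q`, as a map. -/
noncomputable def universalFrattiniMap (Q : ProfiniteGrp.{u}) : universalFrattiniCover Q →ₜ* Q :=
  (exists_universalFrattiniCover Q).choose_spec.choose

theorem universalFrattiniMap_spec (Q : ProfiniteGrp.{u}) :
    IsUniversalFrattiniCover (universalFrattiniMap Q) :=
  (exists_universalFrattiniCover Q).choose_spec.choose_spec

/-- The profinite completion of a group. -/
noncomputable abbrev profCompl (G : Type u) [Group G] : ProfiniteGrp.{u} :=
  ProfiniteGrp.profiniteCompletion.obj (GrpCat.of G)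

/-- The continuous homomorphism of profinite completions induced by a group homomorphism. -/
noncomputable def profComplMap {G H : Type u} [Group G] [Group H] (f : G →* H) :
    profCompl G →ₜ* profCompl H :=
  (ProfiniteGrp.profiniteCompletion.map (GrpCat.ofHom f)).hom

/-- The kernel of the universal Frattini cover of a profinite group `Q`, with the subspace
topology. -/
noncomputable abbrev frattiniKernelProfinite (Q : ProfiniteGrp.{u}) :
    Subgroup (universalFrattiniCover Q) :=
  (universalFrattiniMap Q : universalFrattiniCover Q →* Q).ker

/-- The universal Frattini kernel of an abstract group `G`: the kernel of the universal Frattini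
cover of the profinite completion of `G`. -/
noncomputable abbrev frattiniKernel (G : Type u) [Group G] :
    Subgroup (universalFrattiniCover (profCompl G)) :=
  frattiniKernelProfinite (profCompl G)

/-- The preimage, in the universal Frattini cover of the profinite completion of `G ∗ H`, of the
image of the profinite completion of `G` under the map induced by the inclusion of `G`. -/
noncomputable abbrev preimageOfFactor (G H : Type u) [Group G] [Group H] :
    Subgroup (universalFrattiniCover (profCompl (Monoid.Coprod G H))) :=
  (profComplMap (Monoid.Coprod.inl : G →* Monoid.Coprod G H) :
      profCompl G →* profCompl (Monoid.Coprod G H)).range.comap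
    (universalFrattiniMap (profCompl (Monoid.Coprod G H)) :
      universalFrattiniCover (profCompl (Monoid.Coprod G H)) →* profCompl (Monoid.Coprod G H))

theorem frattiniKernel_le_preimageOfFactor (G H : Type u) [Group G] [Group H] :
    frattiniKernel (Monoid.Coprod G H) ≤ preimageOfFactor G H :=
  (Subgroup.comap_mono bot_le)

/-!
Write `p : P → A` for the universal Frattini cover of `A = Ĝ` and `q : R → B` for that of the
profinite completion `B` of `G ∗ H`. Since `G` is a retract of `G ∗ H`, `ρ ∘ ι = id` on `A`; in
particular `ι` is injective.

Let `D = q⁻¹(ι(A))` and let `ψ : D → P` satisfy `ι ∘ p ∘ ψ = q`. The composite `p ∘ ψ` maps `D` onto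
`A`, because `ι` is injective and `q` is onto; as `D` is compact, `ψ(D)` is a closed subgroup of `P`
mapping onto `A`, so `ψ(D) = P` by the Frattini property. Moreover `p (ψ x) = 1` exactly when
`q x = 1`, so `ψ⁻¹(ker p) = ker q`, and surjectivity of `ψ` gives `ψ(ker q) = ker p`. This is
`exists_surjective_kernel_restriction`; it needs only that `q` is onto and `p` is a Frattini cover.

The map `Φ : R → P` is obtained by lifting `ρ ∘ q` through `p`, using that `R` is projective. Its
restriction to `D` is a map `ψ` as above, because `ι ∘ ρ` is the identity on `ι(A)`.
-/

/-- A continuous homomorphism from a compact group to the domain of a Frattini cover is surjective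
as soon as its composite with the cover is. -/
theorem IsFrattiniCover.surjective_of_comp {E Q : ProfiniteGrp.{u}} {f : E →ₜ* Q}
    (hf : IsFrattiniCover f) {D : Type*} [Group D] [TopologicalSpace D] [CompactSpace D]
    (ψ : D →ₜ* E) (h : Function.Surjective fun x => f (ψ x)) : Function.Surjective ψ := by
  have hcl : IsClosed ((ψ : D →* E).range : Set E) := (isCompact_range ψ.continuous_toFun).isClosed
  have htop : (ψ : D →* E).range = ⊤ := by
    rw [hf.2 _ hcl, eq_top_iff]
    rintro y -
    obtain ⟨x, hx⟩ := h y
    exact ⟨ψ x, ⟨x, rfl⟩, hx⟩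
  exact MonoidHom.range_eq_top.1 htop

/-- The step producing both epimorphisms of kernels: `ψ` is onto by the Frattini property of `p`, and
the full preimage under `ψ` of `ker p` is `ker q` because `ι` is injective. The group `R` need not
be projective. -/
theorem exists_surjective_kernel_restriction {P A R B : ProfiniteGrp.{u}} {p : P →ₜ* A}
    {q : R →ₜ* B} {ι : A →ₜ* B} (hp : IsFrattiniCover p) (hq : Function.Surjective q)
    (hι : Function.Injective ι)
    (ψ : (ι : A →* B).range.comap (q : R →* B) →ₜ* P) (hψ : ∀ x, ι (p (ψ x)) = q x)
    (hle : (q : R →* B).ker ≤ (ι : A →* B).range.comap (q : R →* B)) :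
    ∃ κ : (q : R →* B).ker →ₜ* (p : P →* A).ker,
      (∀ k, (κ k : P) = ψ (Subgroup.inclusion hle k)) ∧ Function.Surjective κ := by
  have hcl : IsClosed ((ι : A →* B).range.comap (q : R →* B) : Set R) :=
    (isCompact_range ι.continuous_toFun).isClosed.preimage q.continuous_toFun
  have : CompactSpace ((ι : A →* B).range.comap (q : R →* B)) :=
    isCompact_iff_compactSpace.1 hcl.isCompact
  have hsurj : Function.Surjective ψ := by
    refine hp.surjective_of_comp ψ fun a => ?_
    obtain ⟨x, hx⟩ := hq (ι a)
    exact ⟨⟨x, a, hx.symm⟩, hι ((hψ _).trans hx)⟩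
  have hmem : ∀ x, p (ψ x) = 1 ↔ q x = 1 := fun x => by
    rw [← hψ x, map_eq_one_iff ι hι]
  refine ⟨⟨((ψ : _ →* P).comp (Subgroup.inclusion hle)).codRestrict _
    fun k => (hmem (Subgroup.inclusion hle k)).2 k.2, ?_⟩, fun k => rfl, ?_⟩
  · exact (ψ.continuous_toFun.comp (continuous_inclusion hle)).subtype_mk _
  · rintro ⟨y, hy⟩
    obtain ⟨x, rfl⟩ := hsurj y
    exact ⟨⟨x, (hmem x).1 hy⟩, rfl⟩

theorem profComplMap_fst_inl (G H : Type u) [Group G] [Group H] (a : profCompl G) :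
    profComplMap (Monoid.Coprod.fst : Monoid.Coprod G H →* G)
      (profComplMap (Monoid.Coprod.inl : G →* Monoid.Coprod G H) a) = a := by
  have h : CategoryTheory.CategoryStruct.comp
      (GrpCat.ofHom (Monoid.Coprod.inl : G →* Monoid.Coprod G H))
      (GrpCat.ofHom (Monoid.Coprod.fst : Monoid.Coprod G H →* G)) =
        CategoryTheory.CategoryStruct.id (GrpCat.of G) := by
    rw [← GrpCat.ofHom_comp, Monoid.Coprod.fst_comp_inl]
    rfl
  have h' : CategoryTheory.CategoryStruct.comp
      (ProfiniteGrp.profiniteCompletion.map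
        (GrpCat.ofHom (Monoid.Coprod.inl : G →* Monoid.Coprod G H)))
      (ProfiniteGrp.profiniteCompletion.map
        (GrpCat.ofHom (Monoid.Coprod.fst : Monoid.Coprod G H →* G))) =
        CategoryTheory.CategoryStruct.id (profCompl G) := by
    rw [← CategoryTheory.Functor.map_comp, h, CategoryTheory.Functor.map_id]
  exact congrArg (fun φ => φ.hom a) h'

theorem mainTheorem6 (G H : Type u) [Group G] [Group H] :
    (∃ (Φ : universalFrattiniCover (profCompl (Monoid.Coprod G H)) →ₜ*
          universalFrattiniCover (profCompl G))
        (κ : frattiniKernel (Monoid.Coprod G H) →ₜ* frattiniKernel G),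
      (∀ x, universalFrattiniMap (profCompl G) (Φ x) =
        profComplMap (Monoid.Coprod.fst : Monoid.Coprod G H →* G)
          (universalFrattiniMap (profCompl (Monoid.Coprod G H)) x)) ∧
      (∀ k, (κ k : universalFrattiniCover (profCompl G)) = Φ k) ∧
      Function.Surjective κ) ∧
    ∀ ψ : preimageOfFactor G H →ₜ* universalFrattiniCover (profCompl G),
      (∀ x, profComplMap (Monoid.Coprod.inl : G →* Monoid.Coprod G H)
          (universalFrattiniMap (profCompl G) (ψ x)) =
        universalFrattiniMap (profCompl (Monoid.Coprod G H)) x) →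
      ∃ κ : frattiniKernel (Monoid.Coprod G H) →ₜ* frattiniKernel G,
        (∀ k, (κ k : universalFrattiniCover (profCompl G)) =
          ψ (Subgroup.inclusion (frattiniKernel_le_preimageOfFactor G H) k)) ∧
        Function.Surjective κ := by
  have hp := universalFrattiniMap_spec (profCompl G)
  have hq := universalFrattiniMap_spec (profCompl (Monoid.Coprod G H))
  have hret := profComplMap_fst_inl G H
  have hrestrict : ∀ ψ : preimageOfFactor G H →ₜ* universalFrattiniCover (profCompl G),
      (∀ x, profComplMap (Monoid.Coprod.inl : G →* Monoid.Coprod G H)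
          (universalFrattiniMap (profCompl G) (ψ x)) =
        universalFrattiniMap (profCompl (Monoid.Coprod G H)) x) →
      ∃ κ : frattiniKernel (Monoid.Coprod G H) →ₜ* frattiniKernel G,
        (∀ k, (κ k : universalFrattiniCover (profCompl G)) =
          ψ (Subgroup.inclusion (frattiniKernel_le_preimageOfFactor G H) k)) ∧
        Function.Surjective κ := fun ψ hψ =>
    exists_surjective_kernel_restriction hp.1 hq.1.1 (Function.LeftInverse.injective hret) ψ hψ
      (frattiniKernel_le_preimageOfFactor G H)
  refine ⟨?_, hrestrict⟩
  obtain ⟨Φ, hΦ⟩ := hq.2 _ _ (universalFrattiniMap (profCompl G))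
    ((profComplMap (Monoid.Coprod.fst : Monoid.Coprod G H →* G)).comp
      (universalFrattiniMap (profCompl (Monoid.Coprod G H)))) hp.1.1
  have hΦ' : ∀ x, universalFrattiniMap (profCompl G) (Φ x) =
      profComplMap (Monoid.Coprod.fst : Monoid.Coprod G H →* G)
        (universalFrattiniMap (profCompl (Monoid.Coprod G H)) x) := hΦ
  obtain ⟨κ, hκ, hκs⟩ := hrestrict
    ⟨(Φ : _ →* _).comp (preimageOfFactor G H).subtype,
      Φ.continuous_toFun.comp continuous_subtype_val⟩ (by
      intro x
      obtain ⟨a, ha⟩ := x.2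
      -- `ha` says that `q x = ι a`, and `ι (ρ (ι a)) = ι a`
      have ha' : profComplMap (Monoid.Coprod.inl : G →* Monoid.Coprod G H) a =
        universalFrattiniMap (profCompl (Monoid.Coprod G H)) x := ha
      change profComplMap _ (universalFrattiniMap (profCompl G) (Φ x)) = _
      rw [hΦ', ← ha', hret])
  exact ⟨Φ, κ, hΦ', hκ, hκs⟩
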